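/- Let $n\ge k\ge 1$ be integers. Let $H_m$ be the classical Hermite polynomials, $\varphi_m(x)=e^{-x^2/2}H_m(x)$ for $m \ge 0$, and, on $\mathbb C\setminus\{0\}$, let $$\varphi_{(n,k)}=\frac{\mathrm{Wr}[\varphi_1,\varphi_3,\dots,\varphi_{2k-1},\varphi_{n+k}]}{\mathrm{Wr}[\varphi_1,\varphi_3,\dots,\varphi_{2k-1}]},\qquad u_{(n,k)}(x)=e^{x^2/2}\varphi_{(n,k)}(x),$$ where $\mathrm{Wr}$ denotes the Wronskian determinant. Consider on $\mathbb C\setminus\{0\}$ the differential equation $$u''(x)-2xu'(x)+\Bigl(2n-\frac{k(k+1)}{x^2}\Bigr)u(x)=0 .\qquad (*)$$ For $a_0,b_0\in\mathbb C$ put $$u_1(z)=a_0z^{k+1}\sum_{j=0}^{\infty}(-1)^j\frac{(n-k-1)(n-k-3)\cdots(n-k-2j+1)}{j!\,(2k+3)(2k+5)\cdots(2k+2j+1)}z^{2j},$$ $$u_2(z)=b_0z^{-k}\sum_{j=0}^{\infty}\frac{(n+k)(n+k-2)\cdots(n+k-2j+2)}{j!\,(2k-1)(2k-3)\cdots(2k-2j+1)}z^{2j}.$$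 Then both power series converge for every $z\in\mathbb C$, and $u_1$ and $u_2$ are holomorphic solutions of $(*)$ on $\mathbb C\setminus\{0\}$, linearly independent over $\mathbb C$ whenever $a_0\ne0$ and $b_0\neq 0$. If $n-k$ is odd, then $u_1=u_{(n,k)}$ on $\mathbb C\setminus\{0\}$ for a suitable choice of $a_0\neq 0$; if $n-k$ is even, then $u_2=u_{(n,k)}$ on $\mathbb C\setminus\{0\}$ for a suitable choice of $b_0\ne 0$. -/

import Mathlib

namespace WronskianHermite

noncomputable section

/-- The classical (physicists') Hermite polynomial `H_n` as a function on `ℂ`, obtained from the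
probabilists' Hermite polynomial `He_n = Polynomial.hermite n` by
`H_n(x) = 2 ^ (n / 2) * He_n(√2 * x)`. -/
def hermiteH (n : ℕ) (x : ℂ) : ℂ :=
  ((Real.sqrt 2 : ℝ) : ℂ) ^ n *
    Polynomial.aeval (((Real.sqrt 2 : ℝ) : ℂ) * x) (Polynomial.hermite n)

/-- The Hermite function `φ_n(x) = e^{-x²/2} H_n(x)`. -/
def phi (n : ℕ) (x : ℂ) : ℂ :=
  Complex.exp (-x ^ 2 / 2) * hermiteH n x

/-- The Wronskian determinant `Wr[f_0, …, f_{r-1}](x) = det (f_j^{(i)}(x))`. -/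
def wronskian {r : ℕ} (f : Fin r → ℂ → ℂ) (x : ℂ) : ℂ :=
  (Matrix.of fun i j : Fin r => iteratedDeriv (i : ℕ) (f j) x).det

/-- The list of functions `φ_1, φ_3, …, φ_{2k-1}`. -/
def oddPhi (k : ℕ) : Fin k → ℂ → ℂ :=
  fun i => phi (2 * (i : ℕ) + 1)

/-- `φ_{(n,k)} = Wr[φ_1, φ_3, …, φ_{2k-1}, φ_{n+k}] / Wr[φ_1, φ_3, …, φ_{2k-1}]`,
a function on `ℂ \ {0}` (its value at `0` is never used). -/
def phiPair (n k : ℕ) (x : ℂ) : ℂ :=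
  wronskian (Fin.snoc (oddPhi k) (phi (n + k)) : Fin (k + 1) → ℂ → ℂ) x /
    wronskian (oddPhi k) x

/-- The function `u_{(n,k)}` determined by `φ_{(n,k)}(x) = e^{-x²/2} u_{(n,k)}(x)`. -/
def uPair (n k : ℕ) (x : ℂ) : ℂ :=
  Complex.exp (x ^ 2 / 2) * phiPair n k x

/-- `u` is holomorphic on `ℂ \ {0}` and satisfies there
`u'' - 2 x u' + (2 n - k (k + 1) / x²) u = 0`. -/
def IsSolution (n k : ℕ) (u : ℂ → ℂ) : Prop :=
  DifferentiableOn ℂ u {0}ᶜ ∧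
    ∀ x : ℂ, x ≠ 0 →
      deriv (deriv u) x - 2 * x * deriv u x
        + (2 * (n : ℂ) - (k : ℂ) * ((k : ℂ) + 1) / x ^ 2) * u x = 0

/-- The coefficient
`(-1)^j (n-k-1)(n-k-3)⋯(n-k-2j+1) / (j! (2k+3)(2k+5)⋯(2k+2j+1))`. -/
def coeffA (n k j : ℕ) : ℂ :=
  (-1) ^ j * (∏ i ∈ Finset.range j, ((n : ℂ) - (k : ℂ) - (2 * (i : ℂ) + 1))) /
    ((j.factorial : ℂ) * ∏ i ∈ Finset.range j, (2 * (k : ℂ) + (2 * (i : ℂ) + 3)))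

/-- The coefficient
`(n+k)(n+k-2)⋯(n+k-2j+2) / (j! (2k-1)(2k-3)⋯(2k-2j+1))`. -/
def coeffB (n k j : ℕ) : ℂ :=
  (∏ i ∈ Finset.range j, ((n : ℂ) + (k : ℂ) - 2 * (i : ℂ))) /
    ((j.factorial : ℂ) * ∏ i ∈ Finset.range j, (2 * (k : ℂ) - (2 * (i : ℂ) + 1)))

/-- `u₁(z) = a₀ z^{k+1} ∑ⱼ coeffA n k j * z^{2j}`. -/
def uOne (n k : ℕ) (a₀ : ℂ) (z : ℂ) : ℂ :=
  a₀ * z ^ (k + 1) * ∑' j : ℕ, coeffA n k j * z ^ (2 * j)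

/-- `u₂(z) = b₀ z^{-k} ∑ⱼ coeffB n k j * z^{2j}`. -/
def uTwo (n k : ℕ) (b₀ : ℂ) (z : ℂ) : ℂ :=
  b₀ * z ^ (-(k : ℤ)) * ∑' j : ℕ, coeffB n k j * z ^ (2 * j)

end

end WronskianHermite

/-! Writing `u = z^s g(z^2)` with `s (s - 1) = k (k + 1)`, that is `s = k + 1` or `s = -k`, turns
the equation into Kummer's equation with `a = (s - n)/2` and `b = s + 1/2`. Since `b` is a
half-integer, the recurrence never degenerates and both exponents give entire series `g`.

The Wronskian quotient is computed without using the differential equation. A monic operator `L` of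
order `k`, the product of the `d/dx + x - j/x`, sends `e^{-x²/2} x^m` to `(m-1)(m-3)⋯(m-2k+1)
e^{-x²/2} x^{m-k}`, so it kills `φ_1, …, φ_{2k-1}`. Row reduction then gives `φ_{(n,k)} = L φ_{n+k}`
(`wronskian_snoc_oddPhi`, `wronskian_oddPhi_ne_zero`). The coefficients of `L φ_{n+k}` inherit a
two-term recurrence from the Hermite coefficients (`crumCoeff_recurrence`), and it is Kummer's. The
first surviving power is `z^{k+1}` for `n + k` odd and `z^{-k}` for `n + k` even, so
`IsKummer.eq_mul` identifies the series. -/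

namespace WronskianHermite

/-! ### Entire power series and Kummer's equation -/

/-- The two-term recurrence of the coefficients of Kummer's function `₁F₁(a; b; w)`. -/
def IsKummer (a b : ℂ) (c : ℕ → ℂ) : Prop :=
  (∀ j : ℕ, (j : ℂ) + b ≠ 0) ∧
    ∀ j : ℕ, ((j : ℂ) + 1) * ((j : ℂ) + b) * c (j + 1) = ((j : ℂ) + a) * c j

theorem IsKummer.summable {a b : ℂ} {c : ℕ → ℂ} (h : IsKummer a b c) (w : ℂ) :
    Summable fun j : ℕ => c j * w ^ j := by
  -- For `j ≥ J` this forces `‖b‖ ≤ j/2`, `‖w‖ (1 + ‖a‖) ≤ j/4` and `j ≥ 1`, which make the ratio of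
  -- consecutive terms at most `1/2`.
  obtain ⟨J, hJ⟩ := exists_nat_gt (4 * ‖w‖ * (2 + ‖a‖) + 2 * ‖b‖ + 1)
  refine summable_of_ratio_norm_eventually_le (r := 1 / 2) (by norm_num) ?_
  filter_upwards [Filter.eventually_ge_atTop J] with j hj
  have hj' : (J : ℝ) ≤ j := by exact_mod_cast hj
  have h1 : ‖(j : ℂ) + 1‖ = (j : ℝ) + 1 := by
    rw [← Nat.cast_succ, Complex.norm_natCast]; push_cast; rfl
  have hw := norm_nonneg w
  have ha := norm_nonneg a
  have hb := norm_nonneg b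
  have hwa : 0 ≤ ‖w‖ * (2 + ‖a‖) := by positivity
  have h2 : (j : ℝ) / 2 ≤ ‖(j : ℂ) + b‖ := by
    have := norm_sub_le_norm_add (j : ℂ) b
    rw [Complex.norm_natCast] at this
    linarith
  have h3 : ‖(j : ℂ) + a‖ ≤ j * (1 + ‖a‖) := by
    have := norm_add_le (j : ℂ) a
    rw [Complex.norm_natCast] at this
    nlinarith
  have hjpos : (0 : ℝ) < j := by linarith
  have hn : ((j : ℝ) + 1) * ‖(j : ℂ) + b‖ * ‖c (j + 1)‖ = ‖(j : ℂ) + a‖ * ‖c j‖ := by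
    have := congrArg norm (h.2 j)
    simpa only [norm_mul, h1] using this
  have hc := norm_nonneg (c j)
  have hc' := norm_nonneg (c (j + 1))
  have h4 : (j : ℝ) * ((j / 2) * ‖c (j + 1)‖) ≤ j * ((1 + ‖a‖) * ‖c j‖) := by
    calc (j : ℝ) * ((j / 2) * ‖c (j + 1)‖)
        ≤ ((j : ℝ) + 1) * (‖(j : ℂ) + b‖ * ‖c (j + 1)‖) := by gcongr; linarith
      _ = ‖(j : ℂ) + a‖ * ‖c j‖ := by rw [← hn]; ring
      _ ≤ j * (1 + ‖a‖) * ‖c j‖ := by gcongr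
      _ = _ := by ring
  have h5 := le_of_mul_le_mul_left h4 hjpos
  have h6 : ‖c (j + 1)‖ * ‖w‖ ≤ 1 / 2 * ‖c j‖ := by
    have h7 : (j : ℝ) / 2 * (‖c (j + 1)‖ * ‖w‖) ≤ (j : ℝ) / 2 * (1 / 2 * ‖c j‖) := by
      calc (j : ℝ) / 2 * (‖c (j + 1)‖ * ‖w‖) = (j / 2 * ‖c (j + 1)‖) * ‖w‖ := by ring
        _ ≤ ((1 + ‖a‖) * ‖c j‖) * ‖w‖ := by gcongr
        _ = (‖w‖ * (1 + ‖a‖)) * ‖c j‖ := by ring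
        _ ≤ (j / 4) * ‖c j‖ := by gcongr; linarith
        _ = _ := by ring
    exact le_of_mul_le_mul_left h7 (by positivity)
  calc ‖c (j + 1) * w ^ (j + 1)‖ = (‖c (j + 1)‖ * ‖w‖) * ‖w‖ ^ j := by
        rw [norm_mul, norm_pow]; ring
    _ ≤ (1 / 2 * ‖c j‖) * ‖w‖ ^ j := by gcongr
    _ = _ := by rw [norm_mul, norm_pow]; ring

/-- Differentiating a Kummer series raises both parameters by one; this yields convergence of the
first two derivative series. -/
theorem IsKummer.shift {a b : ℂ} {c : ℕ → ℂ} (h : IsKummer a b c) :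
    IsKummer (a + 1) (b + 1) fun j => ((j : ℂ) + 1) * c (j + 1) := by
  refine ⟨fun j => ?_, fun j => ?_⟩
  · have := h.1 (j + 1)
    push_cast at this
    rwa [add_assoc, add_comm 1 b] at this
  · have := h.2 (j + 1)
    push_cast at this ⊢
    linear_combination ((j : ℂ) + 1) * this

/-- Termwise differentiation of an everywhere convergent power series. -/
theorem hasDerivAt_tsum_pow {c : ℕ → ℂ} (hc : ∀ w : ℂ, Summable fun j : ℕ => c j * w ^ j)
    (w : ℂ) :
    HasDerivAt (fun w => ∑' j : ℕ, c j * w ^ j)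
      (∑' j : ℕ, ((j : ℂ) + 1) * c (j + 1) * w ^ j) w := by
  have hu : Summable fun j : ℕ => ‖c j * ((‖w‖ + 1 : ℝ) : ℂ) ^ j‖ := (hc _).norm
  have hd : ∀ j : ℕ, DifferentiableOn ℂ (fun w : ℂ => c j * w ^ j) (Metric.ball 0 (‖w‖ + 1)) :=
    fun j => by fun_prop
  have hle : ∀ (j : ℕ) (v : ℂ), v ∈ Metric.ball (0 : ℂ) (‖w‖ + 1) →
      ‖c j * v ^ j‖ ≤ ‖c j * ((‖w‖ + 1 : ℝ) : ℂ) ^ j‖ := by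
    intro j v hv
    rw [norm_mul, norm_mul, norm_pow, norm_pow, Complex.norm_real, Real.norm_eq_abs,
      abs_of_nonneg (by positivity)]
    have : ‖v‖ ≤ ‖w‖ + 1 := (mem_ball_zero_iff.mp hv).le
    gcongr
  have hw : w ∈ Metric.ball (0 : ℂ) (‖w‖ + 1) := by simp
  have hD := Complex.differentiableOn_tsum_of_summable_norm hu hd Metric.isOpen_ball hle
  have hS := Complex.hasSum_deriv_of_summable_norm hu hd Metric.isOpen_ball hle hw
  have hD' := (hD.differentiableAt (Metric.isOpen_ball.mem_nhds hw)).hasDerivAt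
  suffices hval : deriv (fun w => ∑' j : ℕ, c j * w ^ j) w =
      ∑' j : ℕ, ((j : ℂ) + 1) * c (j + 1) * w ^ j by rwa [hval] at hD'
  have hder : ∀ j : ℕ, deriv (fun w => c j * w ^ j) w = c j * (j * w ^ (j - 1)) := fun j =>
    ((hasDerivAt_pow j w).const_mul (c j)).deriv
  simp only [hder] at hS
  rw [← hS.tsum_eq, hS.summable.tsum_eq_zero_add]
  simp only [Nat.cast_zero, zero_mul, mul_zero, zero_add]
  refine tsum_congr fun j => ?_
  rw [Nat.add_sub_cancel]
  push_cast
  ring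

/-- Kummer's equation `w g'' + (b - w) g' - a g = 0` for the sum of the series. -/
theorem IsKummer.equation {a b : ℂ} {c : ℕ → ℂ} (h : IsKummer a b c) (w : ℂ) :
    w * (∑' j : ℕ, ((j : ℂ) + 1) * (((j + 1 : ℕ) : ℂ) + 1) * c (j + 1 + 1) * w ^ j)
      + (b - w) * (∑' j : ℕ, ((j : ℂ) + 1) * c (j + 1) * w ^ j)
      - a * ∑' j : ℕ, c j * w ^ j = 0 := by
  have s0 := h.summable w
  have s1 := h.shift.summable w
  have s2 : Summable fun j : ℕ => ((j : ℂ) + 1) * (((j + 1 : ℕ) : ℂ) + 1) * c (j + 1 + 1) * w ^ j := by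
    simpa only [mul_assoc] using h.shift.shift.summable w
  -- `w g'` and `w g''` as series in `w ^ j`
  have t1 : HasSum (fun j : ℕ => (j : ℂ) * c j * w ^ j)
      (w * ∑' j : ℕ, ((j : ℂ) + 1) * c (j + 1) * w ^ j) := by
    rw [← hasSum_nat_add_iff' 1]
    simp only [Finset.range_one, Finset.sum_singleton, Nat.cast_zero, zero_mul, sub_zero]
    convert! s1.hasSum.mul_left w using 2 with j
    push_cast; ring
  have t2 : HasSum (fun j : ℕ => (j : ℂ) * ((j : ℂ) + 1) * c (j + 1) * w ^ j)
      (w * ∑' j : ℕ, ((j : ℂ) + 1) * (((j + 1 : ℕ) : ℂ) + 1) * c (j + 1 + 1) * w ^ j) := by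
    rw [← hasSum_nat_add_iff' 1]
    simp only [Finset.range_one, Finset.sum_singleton, Nat.cast_zero, zero_mul, sub_zero]
    convert! s2.hasSum.mul_left w using 2 with j
    push_cast; ring
  have key := ((t2.add (s1.hasSum.mul_left b)).sub t1).sub (s0.hasSum.mul_left a)
  have hz : (fun j : ℕ => (j : ℂ) * ((j : ℂ) + 1) * c (j + 1) * w ^ j
      + b * (((j : ℂ) + 1) * c (j + 1) * w ^ j) - (j : ℂ) * c j * w ^ j - a * (c j * w ^ j))
      = fun _ => 0 := by
    funext j
    linear_combination w ^ j * h.2 j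
  rw [hz] at key
  have := key.unique hasSum_zero
  linear_combination this

/-- If `g` solves Kummer's equation with `a = (s - n) / 2`, `b = s + 1 / 2` and
`s (s - 1) = k (k + 1)`, then `z ^ s * g (z ^ 2)` is a solution. -/
theorem isSolution_of_isKummer (n k : ℕ) (s : ℤ) (hs : (s : ℂ) * (s - 1) = k * (k + 1))
    {c : ℕ → ℂ} (h : IsKummer (((s : ℂ) - n) / 2) (s + 1 / 2) c) (e : ℂ) :
    IsSolution n k fun z => e * z ^ s * ∑' j : ℕ, c j * z ^ (2 * j) := by
  set g : ℂ → ℂ := fun w => ∑' j : ℕ, c j * w ^ j with hg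
  set g1 : ℂ → ℂ := fun w => ∑' j : ℕ, ((j : ℂ) + 1) * c (j + 1) * w ^ j with hg1
  set g2 : ℂ → ℂ := fun w =>
    ∑' j : ℕ, ((j : ℂ) + 1) * (((j + 1 : ℕ) : ℂ) + 1) * c (j + 1 + 1) * w ^ j with hg2
  have d0 : ∀ w, HasDerivAt g (g1 w) w := hasDerivAt_tsum_pow h.summable
  have d1 : ∀ w, HasDerivAt g1 (g2 w) w := fun w => by
    have := hasDerivAt_tsum_pow h.shift.summable w
    simpa only [hg1, hg2, mul_assoc] using this
  have hu : (fun z : ℂ => e * z ^ s * ∑' j : ℕ, c j * z ^ (2 * j))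
      = fun z => e * z ^ s * g (z ^ 2) := by
    funext z
    simp only [hg, pow_mul]
  rw [hu]
  have dsq : ∀ z : ℂ, HasDerivAt (fun z : ℂ => z ^ 2) (2 * z) z := fun z => by
    simpa using hasDerivAt_pow 2 z
  have dg0 : ∀ z, HasDerivAt (fun z => g (z ^ 2)) (g1 (z ^ 2) * (2 * z)) z := fun z =>
    HasDerivAt.comp (h₂ := g) z (d0 (z ^ 2)) (dsq z)
  have dg1 : ∀ z, HasDerivAt (fun z => g1 (z ^ 2)) (g2 (z ^ 2) * (2 * z)) z := fun z =>
    HasDerivAt.comp (h₂ := g1) z (d1 (z ^ 2)) (dsq z)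
  have D0 : ∀ z : ℂ, z ≠ 0 → HasDerivAt (fun z => e * z ^ s * g (z ^ 2))
      (e * (s * z ^ (s - 1)) * g (z ^ 2) + e * z ^ s * (g1 (z ^ 2) * (2 * z))) z := fun z hz =>
    ((hasDerivAt_zpow s z (Or.inl hz)).const_mul e).fun_mul (dg0 z)
  have D1 : ∀ z : ℂ, z ≠ 0 → HasDerivAt
      (fun z => e * (s * z ^ (s - 1)) * g (z ^ 2) + e * z ^ s * (g1 (z ^ 2) * (2 * z)))
      (e * (s * (((s - 1 : ℤ) : ℂ) * z ^ (s - 1 - 1))) * g (z ^ 2)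
        + e * (s * z ^ (s - 1)) * (g1 (z ^ 2) * (2 * z))
        + (e * (s * z ^ (s - 1)) * (g1 (z ^ 2) * (2 * z))
          + e * z ^ s * (g2 (z ^ 2) * (2 * z) * (2 * z) + g1 (z ^ 2) * 2))) z := fun z hz => by
    have e1 := (((hasDerivAt_zpow (s - 1) z (Or.inl hz)).const_mul (s : ℂ)).const_mul e).fun_mul (dg0 z)
    have e2 := ((hasDerivAt_zpow s z (Or.inl hz)).const_mul e).fun_mul
      ((dg1 z).fun_mul ((hasDerivAt_id' z).const_mul 2))
    have := e1.fun_add e2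
    rwa [mul_one] at this
  refine ⟨fun z hz => (D0 z hz).differentiableAt.differentiableWithinAt, fun z hz => ?_⟩
  -- The formula for the first derivative is only valid off `0`, so it is differentiated as an
  -- identity of germs at `z`.
  have hE : deriv (fun z => e * z ^ s * g (z ^ 2)) =ᶠ[nhds z]
      fun z => e * (s * z ^ (s - 1)) * g (z ^ 2) + e * z ^ s * (g1 (z ^ 2) * (2 * z)) := by
    filter_upwards [isOpen_ne.mem_nhds hz] with y hy using (D0 y hy).deriv
  rw [hE.deriv_eq, (D1 z hz).deriv, (D0 z hz).deriv]
  have heq : z ^ 2 * g2 (z ^ 2) + ((s + 1 / 2 : ℂ) - z ^ 2) * g1 (z ^ 2)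
    - (((s : ℂ) - n) / 2) * g (z ^ 2) = 0 := h.equation (z ^ 2)
  rw [zpow_sub_one₀ hz, zpow_sub_one₀ hz, ← hs]
  push_cast
  field_simp
  -- The left side of the differential equation is `4 e z^s` times Kummer's expression at `z^2`; the
  -- extra `z^2` comes from clearing denominators.
  linear_combination 4 * e * z ^ s * z ^ 2 * heq

end WronskianHermite

namespace WronskianHermite

noncomputable section

/-! ### The Darboux–Crum operator -/

/-- The iterated first-order operator `∏ⱼ (d/dx + x - j/x)`, `j = k, …, 1`, annihilating
`φ₁, φ₃, …, φ_{2k-1}`. -/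
def crum : ℕ → (ℂ → ℂ) → ℂ → ℂ
  | 0, F => F
  | k + 1, F => fun x => deriv (crum k F) x + (x - ((k : ℂ) + 1) / x) * crum k F x

theorem differentiable_iteratedDeriv {F : ℂ → ℂ} (hF : Differentiable ℂ F) (i : ℕ) :
    Differentiable ℂ (iteratedDeriv i F) :=
  (hF.contDiff (n := ((i + 1 : ℕ) : ℕ∞))).differentiable_iteratedDeriv i
    (by exact_mod_cast Nat.lt_succ_self i)

/-- `crum k` is a monic linear differential operator of order `k`. -/
theorem crum_eq (k : ℕ) : ∃ c : ℕ → ℂ → ℂ, (∀ i, DifferentiableOn ℂ (c i) {0}ᶜ) ∧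
    ∀ F : ℂ → ℂ, Differentiable ℂ F → ∀ x : ℂ, x ≠ 0 →
      crum k F x = iteratedDeriv k F x + ∑ i ∈ Finset.range k, c i x * iteratedDeriv i F x := by
  induction k with
  | zero => exact ⟨fun _ _ => 0, fun _ => by fun_prop, fun F _ x _ => by simp [crum]⟩
  | succ k ih =>
    obtain ⟨c, hc, h⟩ := ih
    -- `d` extends `c` by the leading coefficient `1` and by zeros
    set d : ℕ → ℂ → ℂ := fun i x => if i < k then c i x else if i = k then 1 else 0 with hd
    have hdd : ∀ i, DifferentiableOn ℂ (d i) {0}ᶜ := fun i => by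
      rcases lt_trichotomy i k with h1 | h1 | h1
      · simpa only [hd, h1, if_true] using hc i
      · simp only [hd, h1, lt_irrefl, if_true, if_false]; fun_prop
      · simp only [hd, h1.not_gt, h1.ne', if_false]; fun_prop
    have hdk : ∀ x, d k x = 1 := fun x => by simp [hd]
    have h' : ∀ F : ℂ → ℂ, Differentiable ℂ F → ∀ x : ℂ, x ≠ 0 →
        crum k F x = ∑ i ∈ Finset.range (k + 1), d i x * iteratedDeriv i F x := by
      intro F hF x hx
      rw [h F hF x hx, Finset.sum_range_succ, hdk, one_mul, add_comm]
      congr 1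
      refine Finset.sum_congr rfl fun i hi => ?_
      simp only [hd, Finset.mem_range.mp hi, if_true]
    refine ⟨fun i x => deriv (d i) x + (if i = 0 then 0 else d (i - 1) x)
      + (x - ((k : ℂ) + 1) / x) * d i x, fun i => ?_, fun F hF x hx => ?_⟩
    · have h1 : DifferentiableOn ℂ (deriv (d i)) {0}ᶜ := (hdd i).deriv isOpen_compl_singleton
      have h2 : DifferentiableOn ℂ (fun x => if i = 0 then 0 else d (i - 1) x) {0}ᶜ := by
        by_cases h0 : i = 0
        · simp only [h0, if_true]; fun_prop
        · simpa only [h0, if_false] using hdd (i - 1)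
      have h3 : DifferentiableOn ℂ (fun x : ℂ => x - ((k : ℂ) + 1) / x) {0}ᶜ :=
        differentiableOn_id.sub ((differentiableOn_const _).div differentiableOn_id fun x hx => hx)
      exact (h1.add h2).add (h3.mul (hdd i))
    · have hE : crum k F =ᶠ[nhds x]
          fun x => ∑ i ∈ Finset.range (k + 1), d i x * iteratedDeriv i F x := by
        filter_upwards [isOpen_ne.mem_nhds hx] with y hy using h' F hF y hy
      have hD : HasDerivAt (fun x => ∑ i ∈ Finset.range (k + 1), d i x * iteratedDeriv i F x)
          (∑ i ∈ Finset.range (k + 1),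
            (deriv (d i) x * iteratedDeriv i F x + d i x * iteratedDeriv (i + 1) F x)) x := by
        refine HasDerivAt.fun_sum fun i _ => ?_
        have h1 := ((hdd i).differentiableAt (isOpen_ne.mem_nhds hx)).hasDerivAt
        have h2 := (differentiable_iteratedDeriv hF i x).hasDerivAt
        rw [← iteratedDeriv_succ] at h2
        exact h1.fun_mul h2
      change deriv (crum k F) x + (x - ((k : ℂ) + 1) / x) * crum k F x = _
      rw [hE.deriv_eq, hD.deriv, h' F hF x hx]
      have hshift : ∑ i ∈ Finset.range (k + 1), d i x * iteratedDeriv (i + 1) F x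
          = iteratedDeriv (k + 1) F x + ∑ i ∈ Finset.range (k + 1),
            (if i = 0 then 0 else d (i - 1) x) * iteratedDeriv i F x := by
        rw [Finset.sum_range_succ, Finset.sum_range_succ' _ k, hdk]
        simp [add_comm]
      rw [Finset.sum_add_distrib, hshift, Finset.mul_sum]
      simp only [add_mul, Finset.sum_add_distrib, mul_assoc]
      ring

/-- Row reduction of a Wronskian by a monic operator annihilating all but the last function. -/
theorem wronskian_snoc_eq {k : ℕ} (f : Fin k → ℂ → ℂ) (F : ℂ → ℂ) (x : ℂ) (c : ℕ → ℂ)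
    (hf : ∀ j, iteratedDeriv k (f j) x
      + ∑ i ∈ Finset.range k, c i * iteratedDeriv i (f j) x = 0) :
    wronskian (Fin.snoc f F : Fin (k + 1) → ℂ → ℂ) x =
      (iteratedDeriv k F x + ∑ i ∈ Finset.range k, c i * iteratedDeriv i F x)
        * wronskian f x := by
  set A : Matrix (Fin (k + 1)) (Fin (k + 1)) ℂ := Matrix.of fun i j =>
    iteratedDeriv (i : ℕ) ((Fin.snoc f F : Fin (k + 1) → ℂ → ℂ) j) x with hA
  set e : Fin (k + 1) → ℂ := Fin.snoc (fun i : Fin k => c i) 1 with he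
  have hsum : ∀ j, (∑ i, e i • A i) j =
      iteratedDeriv k ((Fin.snoc f F : Fin (k + 1) → ℂ → ℂ) j) x
        + ∑ i ∈ Finset.range k,
          c i * iteratedDeriv i ((Fin.snoc f F : Fin (k + 1) → ℂ → ℂ) j) x := by
    intro j
    rw [Finset.sum_apply, Fin.sum_univ_castSucc, Finset.sum_range, add_comm]
    simp [he, hA]
  -- Replacing the last row by the combination with weights `e` scales the determinant by the last
  -- weight, which is `1`. The new row holds the operator applied to each function, so only its last
  -- entry survives.
  have hdet := Matrix.det_updateRow_sum A (Fin.last k) e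
  have hlast : e (Fin.last k) = 1 := by simp [he]
  rw [hlast, one_smul] at hdet
  change A.det = _
  rw [← hdet, Matrix.det_succ_row _ (Fin.last k), Fin.sum_univ_castSucc]
  rw [Finset.sum_eq_zero, zero_add]
  · rw [Matrix.updateRow_self, hsum, Fin.snoc_last]
    have hsub : (A.updateRow (Fin.last k) (∑ i, e i • A i)).submatrix (Fin.last k).succAbove
        (Fin.last k).succAbove = Matrix.of fun i j : Fin k => iteratedDeriv (i : ℕ) (f j) x := by
      ext i j
      simp [hA, Matrix.updateRow_apply, Fin.castSucc_ne_last]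
    rw [hsub, ← two_mul, pow_mul]
    simp [wronskian]
  · intro j _
    rw [Matrix.updateRow_self, hsum, Fin.snoc_castSucc, hf]
    simp

theorem wronskian_snoc_crum {k : ℕ} {f : Fin k → ℂ → ℂ} {F : ℂ → ℂ}
    (hf : ∀ j, Differentiable ℂ (f j)) (hF : Differentiable ℂ F) {x : ℂ} (hx : x ≠ 0)
    (h0 : ∀ j, crum k (f j) x = 0) :
    wronskian (Fin.snoc f F : Fin (k + 1) → ℂ → ℂ) x = crum k F x * wronskian f x := by
  obtain ⟨c, -, h⟩ := crum_eq k
  rw [h F hF x hx]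
  exact wronskian_snoc_eq f F x (fun i => c i x) fun j => by rw [← h _ (hf j) x hx, h0]

/-- The factor by which `crum k` multiplies `x ^ m`, up to the shift of the exponent. -/
def crumFactor (k m : ℕ) : ℂ := ∏ i ∈ Finset.range k, ((m : ℂ) - (2 * (i : ℂ) + 1))

/-- Conjugation by `e^{-x²/2}` turns `d/dx + x` into `d/dx`, so the next factor multiplies `x^{m-k}`
by `((m - k) - (k + 1)) / x`, giving the new factor `m - (2k + 1)`. -/
theorem crum_exp_mul_sum (k N : ℕ) (h : ℕ → ℂ) {x : ℂ} (hx : x ≠ 0) :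
    crum k (fun x => Complex.exp (-x ^ 2 / 2) * ∑ m ∈ Finset.range N, h m * x ^ m) x =
      Complex.exp (-x ^ 2 / 2) *
        ∑ m ∈ Finset.range N, h m * crumFactor k m * x ^ ((m : ℤ) - k) := by
  induction k generalizing x with
  | zero => simp [crum, crumFactor]
  | succ k ih =>
    have hE : crum k (fun x => Complex.exp (-x ^ 2 / 2) * ∑ m ∈ Finset.range N, h m * x ^ m)
        =ᶠ[nhds x] fun x => Complex.exp (-x ^ 2 / 2) *
          ∑ m ∈ Finset.range N, h m * crumFactor k m * x ^ ((m : ℤ) - k) := by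
      filter_upwards [isOpen_ne.mem_nhds hx] with y hy using ih hy
    have he : HasDerivAt (fun x : ℂ => Complex.exp (-x ^ 2 / 2))
        (Complex.exp (-x ^ 2 / 2) * (-x)) x := by
      have : HasDerivAt (fun x : ℂ => -x ^ 2 / 2) (-x) x := by
        have := ((hasDerivAt_pow 2 x).fun_neg).div_const 2
        convert! this using 1
        push_cast; ring
      exact this.cexp
    have hs : HasDerivAt
        (fun x : ℂ => ∑ m ∈ Finset.range N, h m * crumFactor k m * x ^ ((m : ℤ) - k))
        (∑ m ∈ Finset.range N, h m * crumFactor k m *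
          ((((m : ℤ) - k : ℤ) : ℂ) * x ^ ((m : ℤ) - k - 1))) x :=
      HasDerivAt.fun_sum fun m _ => (hasDerivAt_zpow _ x (Or.inl hx)).const_mul _
    change deriv (crum k _) x + (x - ((k : ℂ) + 1) / x) * crum k _ x = _
    rw [hE.deriv_eq, (he.fun_mul hs).deriv, ih hx]
    have hfin : ∑ m ∈ Finset.range N, h m * crumFactor (k + 1) m * x ^ ((m : ℤ) - (k + 1 : ℕ))
        = ∑ m ∈ Finset.range N, h m * crumFactor k m *
          ((((m : ℤ) - k : ℤ) : ℂ) * x ^ ((m : ℤ) - k - 1))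
          - ((k : ℂ) + 1) / x *
            ∑ m ∈ Finset.range N, h m * crumFactor k m * x ^ ((m : ℤ) - k) := by
      rw [Finset.mul_sum, ← Finset.sum_sub_distrib]
      refine Finset.sum_congr rfl fun m _ => ?_
      rw [crumFactor, Finset.prod_range_succ, ← crumFactor]
      rw [show (m : ℤ) - (k + 1 : ℕ) = (m : ℤ) - k - 1 by push_cast; ring, zpow_sub_one₀ hx]
      push_cast
      field_simp
      ring
    rw [hfin]
    ring

end

end WronskianHermite

namespace WronskianHermite

noncomputable section

/-! ### Coefficients of the Hermite polynomials -/

open Polynomial in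
-- The two identities feed each other: differentiating `He_{N+1} = X He_N - He_N'` and using the
-- equation for `He_N` gives the derivative rule, which in turn gives the equation for `He_{N+1}`.
theorem derivative_hermite_succ (N : ℕ) :
    derivative (hermite (N + 1)) = ((N + 1 : ℕ) : ℤ[X]) * hermite N ∧
      derivative (derivative (hermite N)) - X * derivative (hermite N)
        + (N : ℤ[X]) * hermite N = 0 := by
  have step : ∀ N : ℕ, derivative (derivative (hermite N)) - X * derivative (hermite N)
        + (N : ℤ[X]) * hermite N = 0 →
      derivative (hermite (N + 1)) = ((N + 1 : ℕ) : ℤ[X]) * hermite N := by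
    intro N h
    rw [hermite_succ]
    simp only [derivative_sub, derivative_mul, derivative_X]
    push_cast
    linear_combination -h
  suffices h : derivative (derivative (hermite N)) - X * derivative (hermite N)
      + (N : ℤ[X]) * hermite N = 0 from ⟨step N h, h⟩
  induction N with
  | zero => simp
  | succ N ih =>
    rw [step N ih, hermite_succ]
    simp only [derivative_mul, derivative_natCast]
    push_cast
    ring

theorem coeff_hermite_recurrence (N m : ℕ) :
    ((m : ℤ) + 2) * (m + 1) * (Polynomial.hermite N).coeff (m + 2)
      = (m - N) * (Polynomial.hermite N).coeff m := by
  have h := congrArg (fun p => Polynomial.coeff p m) (derivative_hermite_succ N).2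
  have hX : (Polynomial.X * Polynomial.derivative (Polynomial.hermite N)).coeff m
      = (Polynomial.hermite N).coeff m * m := by
    cases m with
    | zero => simp
    | succ m => rw [Polynomial.coeff_X_mul, Polynomial.coeff_derivative]; push_cast; rfl
  simp only [Polynomial.coeff_add, Polynomial.coeff_sub, Polynomial.coeff_natCast_mul, hX,
    Polynomial.coeff_derivative, Polynomial.coeff_zero] at h
  push_cast at h
  linear_combination h

theorem sqrt_two_sq : ((Real.sqrt 2 : ℝ) : ℂ) ^ 2 = 2 := by
  rw [← Complex.ofReal_pow, Real.sq_sqrt (by norm_num)]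
  norm_num

theorem sqrt_two_ne_zero : ((Real.sqrt 2 : ℝ) : ℂ) ≠ 0 := fun h => by
  have := sqrt_two_sq
  rw [h] at this
  norm_num at this

/-- The coefficient of `x ^ m` in the physicists' Hermite polynomial `H_N`. -/
def hermiteCoeff (N m : ℕ) : ℂ :=
  ((Real.sqrt 2 : ℝ) : ℂ) ^ N * ((Real.sqrt 2 : ℝ) : ℂ) ^ m * ((Polynomial.hermite N).coeff m : ℂ)

theorem hermiteCoeff_recurrence (N m : ℕ) :
    ((m : ℂ) + 2) * (m + 1) * hermiteCoeff N (m + 2) = 2 * (m - N) * hermiteCoeff N m := by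
  have h : ((m : ℂ) + 2) * (m + 1) * ((Polynomial.hermite N).coeff (m + 2) : ℂ)
      = (m - N) * ((Polynomial.hermite N).coeff m : ℂ) := by
    exact_mod_cast congrArg (Int.cast : ℤ → ℂ) (coeff_hermite_recurrence N m)
  rw [hermiteCoeff, hermiteCoeff, pow_add _ m 2, sqrt_two_sq]
  linear_combination 2 * ((Real.sqrt 2 : ℝ) : ℂ) ^ N * ((Real.sqrt 2 : ℝ) : ℂ) ^ m * h

theorem hermiteCoeff_eq_zero_of_lt {N m : ℕ} (h : N < m) : hermiteCoeff N m = 0 := by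
  simp [hermiteCoeff, Polynomial.coeff_hermite_of_lt h]

theorem hermiteCoeff_eq_zero_of_odd_add {N m : ℕ} (h : Odd (N + m)) : hermiteCoeff N m = 0 := by
  simp [hermiteCoeff, Polynomial.coeff_hermite_of_odd_add h]

theorem hermiteCoeff_ne_zero {N m : ℕ} (hm : m ≤ N) (h : Even (N + m)) :
    hermiteCoeff N m ≠ 0 := by
  rw [hermiteCoeff, Polynomial.coeff_hermite_of_even_add h]
  have h1 := Nat.doubleFactorial_pos (N - m - 1)
  have h2 := Nat.choose_pos hm
  refine mul_ne_zero (mul_ne_zero (pow_ne_zero _ sqrt_two_ne_zero)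
    (pow_ne_zero _ sqrt_two_ne_zero)) (Int.cast_ne_zero.mpr ?_)
  refine mul_ne_zero (mul_ne_zero (pow_ne_zero _ (by norm_num)) ?_) ?_
  · exact_mod_cast h1.ne'
  · exact_mod_cast h2.ne'

theorem phi_eq {N M : ℕ} (h : N < M) :
    phi N = fun x => Complex.exp (-x ^ 2 / 2) * ∑ m ∈ Finset.range M, hermiteCoeff N m * x ^ m := by
  funext x
  rw [phi, hermiteH, Polynomial.aeval_eq_sum_range' (n := M) (by simpa using h), Finset.mul_sum]
  congr 1
  refine Finset.sum_congr rfl fun m _ => ?_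
  rw [hermiteCoeff, mul_pow, zsmul_eq_mul]
  ring

theorem differentiable_phi (N : ℕ) : Differentiable ℂ (phi N) := by
  rw [phi_eq (Nat.lt_succ_self N)]
  fun_prop

/-! ### Explicit form of `u_{(n,k)}` -/

/-- The products telescope: passing from `m` to `m + 2` gains the factor `m + 1` and loses `m + 1 -
2k`. -/
theorem crumFactor_add_two (k m : ℕ) :
    crumFactor k (m + 2) * ((m : ℂ) + 1 - 2 * k) = crumFactor k m * (m + 1) := by
  induction k with
  | zero => simp [crumFactor]
  | succ k ih =>
    rw [crumFactor, crumFactor, Finset.prod_range_succ, Finset.prod_range_succ, ← crumFactor,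
      ← crumFactor]
    push_cast
    linear_combination ((m : ℂ) - (2 * k + 1)) * ih

theorem crumFactor_ne_zero {k m : ℕ} (h : ∀ i < k, m ≠ 2 * i + 1) : crumFactor k m ≠ 0 := by
  refine Finset.prod_ne_zero_iff.mpr fun i hi => sub_ne_zero.mpr ?_
  exact_mod_cast h i (Finset.mem_range.mp hi)

theorem crumFactor_eq_zero {k i : ℕ} (h : i < k) : crumFactor k (2 * i + 1) = 0 :=
  Finset.prod_eq_zero (Finset.mem_range.mpr h) (by push_cast; ring)

/-- The coefficient of `x ^ (m - k)` in `e^{x²/2} crum k φ_N`. -/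
def crumCoeff (N k m : ℕ) : ℂ := hermiteCoeff N m * crumFactor k m

theorem crum_phi {N M : ℕ} (k : ℕ) (h : N < M) {x : ℂ} (hx : x ≠ 0) :
    crum k (phi N) x = Complex.exp (-x ^ 2 / 2) *
      ∑ m ∈ Finset.range M, crumCoeff N k m * x ^ ((m : ℤ) - k) := by
  rw [phi_eq h, crum_exp_mul_sum k M _ hx]
  rfl

theorem crumCoeff_eq_zero_of_lt {N m : ℕ} (k : ℕ) (h : N < m) : crumCoeff N k m = 0 := by
  rw [crumCoeff, hermiteCoeff_eq_zero_of_lt h, zero_mul]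

theorem crumCoeff_eq_zero_of_odd_add {N m : ℕ} (k : ℕ) (h : Odd (N + m)) :
    crumCoeff N k m = 0 := by
  rw [crumCoeff, hermiteCoeff_eq_zero_of_odd_add h, zero_mul]

/-- For odd `N` only the powers `x ^ m` with `m` odd and `2 k < m` survive. -/
theorem crumCoeff_eq_zero_of_lt_of_odd {N k m : ℕ} (hN : Odd N) (h : m < 2 * k + 1) :
    crumCoeff N k m = 0 := by
  rcases Nat.even_or_odd m with hm | ⟨i, rfl⟩
  · exact crumCoeff_eq_zero_of_odd_add k (hN.add_even hm)
  · rw [crumCoeff, crumFactor_eq_zero (by omega), mul_zero]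

theorem crumCoeff_recurrence (N k m : ℕ) :
    ((m : ℂ) + 2) * (m + 1 - 2 * k) * crumCoeff N k (m + 2) = 2 * (m - N) * crumCoeff N k m := by
  have h : (m : ℂ) + 1 ≠ 0 := Nat.cast_add_one_ne_zero m
  refine mul_left_cancel₀ h ?_
  rw [crumCoeff, crumCoeff]
  linear_combination (crumFactor k (m + 2) * ((m : ℂ) + 1 - 2 * k)) * hermiteCoeff_recurrence N m
    + 2 * ((m : ℂ) - N) * hermiteCoeff N m * crumFactor_add_two k m

theorem crum_phi_odd_eq_zero {k j : ℕ} (h : j < k) {x : ℂ} (hx : x ≠ 0) :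
    crum k (phi (2 * j + 1)) x = 0 := by
  rw [crum_phi k (Nat.lt_succ_self _) hx, Finset.sum_eq_zero, mul_zero]
  intro m hm
  have := Finset.mem_range.mp hm
  rw [crumCoeff_eq_zero_of_lt_of_odd ⟨j, rfl⟩ (by omega), zero_mul]

/-- Only the top power of `H_{2k+1}` escapes annihilation. The value is the ratio of consecutive
Wronskians of odd Hermite functions, hence their nonvanishing by induction. -/
theorem crum_phi_odd_ne_zero (k : ℕ) {x : ℂ} (hx : x ≠ 0) :
    crum k (phi (2 * k + 1)) x ≠ 0 := by
  rw [crum_phi k (Nat.lt_succ_self _) hx, Finset.sum_range_succ, Finset.sum_eq_zero, zero_add]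
  · exact mul_ne_zero (Complex.exp_ne_zero _) (mul_ne_zero (mul_ne_zero
      (hermiteCoeff_ne_zero le_rfl ⟨_, rfl⟩)
      (crumFactor_ne_zero fun i hi => by omega)) (zpow_ne_zero _ hx))
  · intro m hm
    rw [crumCoeff_eq_zero_of_lt_of_odd ⟨k, rfl⟩ (Finset.mem_range.mp hm), zero_mul]

theorem wronskian_snoc_oddPhi (N k : ℕ) {x : ℂ} (hx : x ≠ 0) :
    wronskian (Fin.snoc (oddPhi k) (phi N) : Fin (k + 1) → ℂ → ℂ) x
      = crum k (phi N) x * wronskian (oddPhi k) x :=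
  wronskian_snoc_crum (fun _ => differentiable_phi _) (differentiable_phi N) hx
    fun j => crum_phi_odd_eq_zero j.2 hx

theorem wronskian_oddPhi_ne_zero (k : ℕ) {x : ℂ} (hx : x ≠ 0) : wronskian (oddPhi k) x ≠ 0 := by
  induction k with
  | zero => simp [wronskian]
  | succ k ih =>
    have h : oddPhi (k + 1) = (Fin.snoc (oddPhi k) (phi (2 * k + 1)) : Fin (k + 1) → ℂ → ℂ) := by
      funext i
      refine Fin.lastCases ?_ (fun i => ?_) i <;> simp [oddPhi]
    rw [h, wronskian_snoc_oddPhi _ _ hx]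
    exact mul_ne_zero (crum_phi_odd_ne_zero k hx) ih

theorem uPair_eq_tsum (n k : ℕ) {z : ℂ} (hz : z ≠ 0) :
    uPair n k z = ∑' m : ℕ, crumCoeff (n + k) k m * z ^ ((m : ℤ) - k) := by
  rw [uPair, phiPair, wronskian_snoc_oddPhi _ _ hz,
    mul_div_cancel_right₀ _ (wronskian_oddPhi_ne_zero k hz), crum_phi k (Nat.lt_succ_self _) hz,
    ← mul_assoc, ← Complex.exp_add, neg_div, add_neg_cancel, Complex.exp_zero, one_mul,
    tsum_eq_sum]
  intro m hm
  rw [crumCoeff_eq_zero_of_lt k (by simpa using hm), zero_mul]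

/-! ### The two series -/

theorem natCast_add_intCast_add_half_ne_zero (j : ℕ) (s : ℤ) : (j : ℂ) + (s + 1 / 2) ≠ 0 := by
  intro h
  have h2 : ((2 * (j + s) + 1 : ℤ) : ℂ) = 0 := by
    push_cast
    linear_combination 2 * h
  have := Int.cast_eq_zero.mp h2
  omega

theorem isKummer_coeffA (n k : ℕ) :
    IsKummer ((((k + 1 : ℤ) : ℂ) - n) / 2) (((k + 1 : ℤ) : ℂ) + 1 / 2) (coeffA n k) := by
  refine ⟨fun j => natCast_add_intCast_add_half_ne_zero j _, fun j => ?_⟩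
  have h0 : ∀ i : ℕ, (2 * (k : ℂ) + (2 * (i : ℂ) + 3)) ≠ 0 := fun i => by
    exact_mod_cast (by omega : 2 * k + (2 * i + 3) ≠ 0)
  have h1 : ∏ i ∈ Finset.range j, (2 * (k : ℂ) + (2 * (i : ℂ) + 3)) ≠ 0 :=
    Finset.prod_ne_zero_iff.mpr fun i _ => h0 i
  have h2 : (j : ℂ) + 1 ≠ 0 := Nat.cast_add_one_ne_zero j
  have h3 : (j.factorial : ℂ) ≠ 0 := by exact_mod_cast j.factorial_ne_zero
  have h4 := h0 j
  rw [coeffA, coeffA, Finset.prod_range_succ, Finset.prod_range_succ, Nat.factorial_succ, pow_succ]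
  generalize ∏ i ∈ Finset.range j, (2 * (k : ℂ) + (2 * (i : ℂ) + 3)) = Q at h1 ⊢
  obtain ⟨q, hq⟩ : ∃ q, q = 2 * (k : ℂ) + (2 * (j : ℂ) + 3) := ⟨_, rfl⟩
  have hk : ((k + 1 : ℤ) : ℂ) + 1 / 2 = q / 2 - j := by rw [hq]; push_cast; ring
  rw [← hq] at h4 ⊢
  rw [hk]
  push_cast
  field_simp
  ring

theorem isKummer_coeffB (n k : ℕ) :
    IsKummer ((((-k : ℤ) : ℂ) - n) / 2) (((-k : ℤ) : ℂ) + 1 / 2) (coeffB n k) := by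
  refine ⟨fun j => natCast_add_intCast_add_half_ne_zero j _, fun j => ?_⟩
  have h0 : ∀ i : ℕ, (2 * (k : ℂ) - (2 * (i : ℂ) + 1)) ≠ 0 := fun i => by
    exact_mod_cast (by omega : 2 * (k : ℤ) - (2 * (i : ℤ) + 1) ≠ 0)
  have h1 : ∏ i ∈ Finset.range j, (2 * (k : ℂ) - (2 * (i : ℂ) + 1)) ≠ 0 :=
    Finset.prod_ne_zero_iff.mpr fun i _ => h0 i
  have h2 : (j : ℂ) + 1 ≠ 0 := Nat.cast_add_one_ne_zero j
  have h3 : (j.factorial : ℂ) ≠ 0 := by exact_mod_cast j.factorial_ne_zero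
  have h4 := h0 j
  rw [coeffB, coeffB, Finset.prod_range_succ, Finset.prod_range_succ, Nat.factorial_succ]
  generalize ∏ i ∈ Finset.range j, (2 * (k : ℂ) - (2 * (i : ℂ) + 1)) = Q at h1 ⊢
  obtain ⟨q, hq⟩ : ∃ q, q = 2 * (k : ℂ) - (2 * (j : ℂ) + 1) := ⟨_, rfl⟩
  -- Here `j + b = -q/2` and `j + a = -(n + k - 2j)/2`; the two signs cancel, so `coeffB` has no
  -- factor `(-1)^j`.
  have hk : ((-k : ℤ) : ℂ) + 1 / 2 = -q / 2 - j := by rw [hq]; push_cast; ring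
  rw [← hq] at h4 ⊢
  rw [hk]
  push_cast
  field_simp
  ring

theorem IsKummer.eq_mul {a b : ℂ} {c d : ℕ → ℂ} (hc : IsKummer a b c) (hd : IsKummer a b d)
    (h0 : c 0 = 1) (j : ℕ) : d j = d 0 * c j := by
  induction j with
  | zero => rw [h0, mul_one]
  | succ j ih =>
    refine mul_left_cancel₀ (mul_ne_zero (Nat.cast_add_one_ne_zero j) (hc.1 j)) ?_
    rw [hd.2, ih]
    linear_combination -d 0 * hc.2 j

theorem isKummer_crumCoeff_odd (n k : ℕ) :
    IsKummer ((((k + 1 : ℤ) : ℂ) - n) / 2) (((k + 1 : ℤ) : ℂ) + 1 / 2)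
      fun j => crumCoeff (n + k) k (2 * k + 1 + 2 * j) := by
  refine ⟨fun j => natCast_add_intCast_add_half_ne_zero j _, fun j => ?_⟩
  have h := crumCoeff_recurrence (n + k) k (2 * k + 1 + 2 * j)
  beta_reduce
  rw [mul_add 2 j 1, ← add_assoc]
  push_cast at h ⊢
  linear_combination h / 4

theorem isKummer_crumCoeff_even (n k : ℕ) :
    IsKummer ((((-k : ℤ) : ℂ) - n) / 2) (((-k : ℤ) : ℂ) + 1 / 2)
      fun j => crumCoeff (n + k) k (2 * j) := by
  refine ⟨fun j => natCast_add_intCast_add_half_ne_zero j _, fun j => ?_⟩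
  have h := crumCoeff_recurrence (n + k) k (2 * j)
  beta_reduce
  rw [mul_add 2 j 1]
  push_cast at h ⊢
  linear_combination h / 4

theorem uOne_eq_uPair {n k : ℕ} (h : Odd (n + k)) {z : ℂ} (hz : z ≠ 0) :
    uOne n k (crumCoeff (n + k) k (2 * k + 1)) z = uPair n k z := by
  have hinj : Function.Injective fun j : ℕ => 2 * k + 1 + 2 * j := fun i j hij => by
    simp only at hij; omega
  -- The sum over `m` is restricted to `m = 2k + 1 + 2j`: parity removes even `m`, and `L` removes
  -- odd `m` below `2k + 1`.
  rw [uPair_eq_tsum n k hz, uOne, ← tsum_mul_left,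
    ← hinj.tsum_eq (f := fun m : ℕ => crumCoeff (n + k) k m * z ^ ((m : ℤ) - k))]
  · refine tsum_congr fun j => ?_
    have he := (isKummer_coeffA n k).eq_mul (isKummer_crumCoeff_odd n k) (by simp [coeffA]) j
    simp only [mul_zero, add_zero] at he
    rw [he, show ((2 * k + 1 + 2 * j : ℕ) : ℤ) - k = ((k + 1 : ℕ) : ℤ) + ((2 * j : ℕ) : ℤ) by
        push_cast; ring, zpow_add₀ hz, zpow_natCast, zpow_natCast]
    ring
  · intro m hm
    have hm0 : crumCoeff (n + k) k m ≠ 0 := left_ne_zero_of_mul hm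
    have h1 : 2 * k + 1 ≤ m := by
      by_contra hlt
      exact hm0 (crumCoeff_eq_zero_of_lt_of_odd h (by omega))
    have h2 : Odd m := by
      by_contra hm'
      exact hm0 (crumCoeff_eq_zero_of_odd_add k (h.add_even (Nat.not_odd_iff_even.mp hm')))
    obtain ⟨i, rfl⟩ := h2
    exact ⟨i - k, by simp only; omega⟩

theorem uTwo_eq_uPair {n k : ℕ} (h : Even (n + k)) {z : ℂ} (hz : z ≠ 0) :
    uTwo n k (crumCoeff (n + k) k 0) z = uPair n k z := by
  have hinj : Function.Injective fun j : ℕ => 2 * j := fun i j hij => by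
    simp only at hij; omega
  rw [uPair_eq_tsum n k hz, uTwo, ← tsum_mul_left,
    ← hinj.tsum_eq (f := fun m : ℕ => crumCoeff (n + k) k m * z ^ ((m : ℤ) - k))]
  · refine tsum_congr fun j => ?_
    have he := (isKummer_coeffB n k).eq_mul (isKummer_crumCoeff_even n k) (by simp [coeffB]) j
    simp only [mul_zero] at he
    rw [he, show ((2 * j : ℕ) : ℤ) - k = -(k : ℤ) + ((2 * j : ℕ) : ℤ) by ring, zpow_add₀ hz,
      zpow_natCast]
    ring
  · intro m hm
    have hm0 : crumCoeff (n + k) k m ≠ 0 := left_ne_zero_of_mul hm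
    have h2 : Even m := by
      by_contra hm'
      exact hm0 (crumCoeff_eq_zero_of_odd_add k (h.add_odd (Nat.not_even_iff_odd.mp hm')))
    obtain ⟨i, rfl⟩ := h2
    exact ⟨i, by simp only; omega⟩

/-- The even power series `∑ cⱼ z^{2j}` is continuous. -/
theorem IsKummer.continuous {a b : ℂ} {c : ℕ → ℂ} (h : IsKummer a b c) :
    Continuous fun z : ℂ => ∑' j : ℕ, c j * z ^ (2 * j) := by
  have h1 : Continuous fun w : ℂ => ∑' j : ℕ, c j * w ^ j :=
    continuous_iff_continuousAt.mpr fun w => (hasDerivAt_tsum_pow h.summable w).continuousAt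
  simpa only [Function.comp_def, ← pow_mul] using h1.comp (continuous_pow 2)

/-- A continuous function vanishing off the origin vanishes at the origin. -/
theorem eq_zero_of_forall_ne {f : ℂ → ℂ} (hf : Continuous f) (h : ∀ z, z ≠ 0 → f z = 0) :
    f 0 = 0 := by
  have : f = fun _ => 0 := hf.ext_on (dense_compl_singleton (0 : ℂ)) continuous_const
    fun z hz => h z hz
  rw [this]

theorem linearIndependent_uOne_uTwo (n k : ℕ) {a₀ b₀ : ℂ} (ha : a₀ ≠ 0) (hb : b₀ ≠ 0) :
    LinearIndependent ℂ
      ![fun z : {z : ℂ // z ≠ 0} => uOne n k a₀ z, fun z : {z : ℂ // z ≠ 0} => uTwo n k b₀ z] := by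
  rw [LinearIndependent.pair_iff]
  intro s t hst
  have hst' : ∀ z : ℂ, z ≠ 0 → s * uOne n k a₀ z + t * uTwo n k b₀ z = 0 := fun z hz =>
    congrFun hst ⟨z, hz⟩
  have cA := (isKummer_coeffA n k).continuous
  have cB := (isKummer_coeffB n k).continuous
  have vA : ∑' j : ℕ, coeffA n k j * (0 : ℂ) ^ (2 * j) = 1 := by
    rw [tsum_eq_single 0 fun j hj => by simp [hj]]
    simp [coeffA]
  have vB : ∑' j : ℕ, coeffB n k j * (0 : ℂ) ^ (2 * j) = 1 := by
    rw [tsum_eq_single 0 fun j hj => by simp [hj]]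
    simp [coeffB]
  have ht : t = 0 := by
    -- The relation multiplied by `z^k` extends continuously to `0`, where the `u₁` part vanishes
    -- and `t b₀` remains.
    have := eq_zero_of_forall_ne
      (f := fun z => s * a₀ * z ^ (2 * k + 1) * (∑' j : ℕ, coeffA n k j * z ^ (2 * j))
        + t * b₀ * ∑' j : ℕ, coeffB n k j * z ^ (2 * j)) (by fun_prop) fun z hz => by
        have h := hst' z hz
        rw [uOne, uTwo, zpow_neg, zpow_natCast] at h
        have hzk := pow_ne_zero k hz
        field_simp at h
        linear_combination h
    simpa [vB, hb] using this
  refine ⟨?_, ht⟩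
  have := eq_zero_of_forall_ne
    (f := fun z => s * a₀ * ∑' j : ℕ, coeffA n k j * z ^ (2 * j)) (by fun_prop) fun z hz => by
      have h := hst' z hz
      rw [ht, zero_mul, add_zero, uOne] at h
      refine mul_left_cancel₀ (pow_ne_zero (k + 1) hz) ?_
      linear_combination h
  simpa [vA, ha] using this

theorem summable_even_of_isKummer {a b : ℂ} {c : ℕ → ℂ} (h : IsKummer a b c) (z : ℂ) :
    Summable fun j : ℕ => c j * z ^ (2 * j) := by
  simpa only [pow_mul] using h.summable (z ^ 2)

theorem isSolution_uOne (n k : ℕ) (a₀ : ℂ) : IsSolution n k (uOne n k a₀) := by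
  have := isSolution_of_isKummer n k (k + 1) (by push_cast; ring) (isKummer_coeffA n k) a₀
  exact_mod_cast this

theorem isSolution_uTwo (n k : ℕ) (b₀ : ℂ) : IsSolution n k (uTwo n k b₀) :=
  isSolution_of_isKummer n k (-k) (by push_cast; ring) (isKummer_coeffB n k) b₀

end

end WronskianHermite

theorem mainTheorem8 (n k : ℕ) (hk : 1 ≤ k) (hkn : k ≤ n) :
    -- both series converge everywhere
    (∀ z : ℂ, Summable fun j : ℕ => WronskianHermite.coeffA n k j * z ^ (2 * j)) ∧
    (∀ z : ℂ, Summable fun j : ℕ => WronskianHermite.coeffB n k j * z ^ (2 * j)) ∧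
    -- both functions solve the equation on the punctured plane
    (∀ a₀ : ℂ, WronskianHermite.IsSolution n k (WronskianHermite.uOne n k a₀)) ∧
    (∀ b₀ : ℂ, WronskianHermite.IsSolution n k (WronskianHermite.uTwo n k b₀)) ∧
    -- they are linearly independent as functions on the punctured plane
    (∀ a₀ b₀ : ℂ, a₀ ≠ 0 → b₀ ≠ 0 →
      LinearIndependent ℂ
        ![fun z : {z : ℂ // z ≠ 0} => WronskianHermite.uOne n k a₀ z,
          fun z : {z : ℂ // z ≠ 0} => WronskianHermite.uTwo n k b₀ z]) ∧
    -- identification with `u_{(n,k)}` according to the parity of `n - k`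
    (Odd ((n : ℤ) - (k : ℤ)) →
      ∃ a₀ : ℂ, a₀ ≠ 0 ∧
        ∀ z : ℂ, z ≠ 0 → WronskianHermite.uOne n k a₀ z = WronskianHermite.uPair n k z) ∧
    (Even ((n : ℤ) - (k : ℤ)) →
      ∃ b₀ : ℂ, b₀ ≠ 0 ∧
        ∀ z : ℂ, z ≠ 0 → WronskianHermite.uTwo n k b₀ z = WronskianHermite.uPair n k z) := by
  refine ⟨fun z => WronskianHermite.summable_even_of_isKummer (WronskianHermite.isKummer_coeffA n k) z,
    fun z => WronskianHermite.summable_even_of_isKummer (WronskianHermite.isKummer_coeffB n k) z,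
    WronskianHermite.isSolution_uOne n k, WronskianHermite.isSolution_uTwo n k,
    fun a₀ b₀ ha hb => WronskianHermite.linearIndependent_uOne_uTwo n k ha hb, fun h => ?_, fun h => ?_⟩
  · have hodd : Odd (n + k) := by
      rw [Int.odd_iff] at h
      rw [Nat.odd_iff]
      omega
    -- Parity excludes `n = k`, so `x^{2k+1}` does occur in `H_{n+k}`; its image under `L` provides
    -- `a₀`.
    have hlt : 2 * k + 1 ≤ n + k := by
      rw [Nat.odd_iff] at hodd
      omega
    exact ⟨_, mul_ne_zero
      (WronskianHermite.hermiteCoeff_ne_zero hlt (hodd.add_odd ⟨k, rfl⟩))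
      (WronskianHermite.crumFactor_ne_zero fun i hi => by omega),
      fun z hz => WronskianHermite.uOne_eq_uPair hodd hz⟩
  · have heven : Even (n + k) := by
      rw [Int.even_iff] at h
      rw [Nat.even_iff]
      omega
    exact ⟨_, mul_ne_zero
      (WronskianHermite.hermiteCoeff_ne_zero (Nat.zero_le _) heven)
      (WronskianHermite.crumFactor_ne_zero fun i hi => by omega),
      fun z hz => WronskianHermite.uTwo_eq_uPair heven hz⟩
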